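/- For a finite metric space $B$, let $Z_B$ be the matrix $Z_B(x,y)=e^{-d(x,y)}$ ($x,y\in B$). A finite metric space is positive definite if $Z_B$ is; then there is a unique $w\in\mathbb{R}^B$ with $\sum_{y} Z_B(x,y)w_y=1$ for all $x\in B$, and the magnitude of $B$ is $|B|=\sum_{x\in B}w_x$. A metric space is positive definite if all its finite subspaces are, and the magnitude of a compact positive definite space $A$ is $|A|=\sup\{|B| : B\subseteq A \text{ finite}\}\in[0,\infty]$. Subsets of $\mathbb{R}$ carry the usual metric. Corollary. Let $A\subseteq\mathbb{R}$ be a nonempty compact set. Then $A$ can be written as $$A=[a,b]\setminus\bigcup_{i\in I}(a_i,b_i),$$ where $a\le b$, $I$ is finite or countable, and the $(a_i,b_i)$ are pairwise disjoint nonempty open subintervals of $[a,b]$. For any such representation, $A$ is positive definite, the series below converges, and $$|A| = 1 + \frac{\operatorname{vol}_1(A)}{2} + \sum_{i\in I} \tanh\frac{b_i-a_i}{2},$$ where $\operatorname{vol}_1$ is Lebesgue measure. In particular, for $\ell>0$ the ternary Cantor set $C_\ell\subseteq[0,\ell]$ of length $\ell$ (the standard ternary Cantor set scaled by $\ell$)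 has magnitude $$|C_\ell| = 1+\frac12\sum_{i=1}^{\infty} 2^i\tanh\frac{\ell}{2\cdot 3^i}.$$ -/

import Mathlib

namespace MetricMagnitude

/-- A weighting on a square matrix: a column vector `w` with `Z w = e`, `e` the all-ones vector. -/
def IsWeighting {ι : Type*} [Fintype ι] (Z : Matrix ι ι ℝ) (w : ι → ℝ) : Prop :=
  Z.mulVec w = 1

/-- A coweighting on a square matrix: a row vector `v` with `v Z = eᵀ`. -/
def IsCoweighting {ι : Type*} [Fintype ι] (Z : Matrix ι ι ℝ) (v : ι → ℝ) : Prop :=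
  Matrix.vecMul v Z = 1

/-- The matrix `Z` has magnitude `m`: it admits a weighting and a coweighting, and `m` is the sum of
the entries of a weighting (equal to the sum of the entries of any coweighting, so that `m` is
unique). -/
def MatrixHasMagnitude {ι : Type*} [Fintype ι] (Z : Matrix ι ι ℝ) (m : ℝ) : Prop :=
  ∃ w v : ι → ℝ, IsWeighting Z w ∧ IsCoweighting Z v ∧ ∑ i, w i = m

/-- The similarity matrix `Z(x, y) = exp (-d(x, y))` of a finite subspace of a metric space. -/
noncomputable def similarityMatrix {X : Type*} [MetricSpace X] (B : Finset X) : Matrix B B ℝ :=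
  Matrix.of fun x y => Real.exp (-dist (x : X) (y : X))

/-- The subspace `A` is a positive definite metric space: the similarity matrix of every finite
subspace is positive definite. -/
def IsPositiveDefinite {X : Type*} [MetricSpace X] (A : Set X) : Prop :=
  ∀ B : Finset X, (B : Set X) ⊆ A → (similarityMatrix B).PosDef

/-- The magnitude of a compact positive definite subspace `A`: the supremum of the magnitudes of its
finite subspaces. (Every finite subspace of a positive definite space has a magnitude.) -/
noncomputable def magnitude {X : Type*} [MetricSpace X] (A : Set X) : EReal :=
  sSup {c : EReal | ∃ (B : Finset X) (m : ℝ),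
    (B : Set X) ⊆ A ∧ MatrixHasMagnitude (similarityMatrix B) m ∧ c = (m : EReal)}

/-- `A` is `[a, b]` minus the disjoint nonempty open subintervals `(l i, r i)` of `[a, b]`. -/
structure IsGapDecomposition (A : Set ℝ) (a b : ℝ) {ι : Type*} (l r : ι → ℝ) : Prop where
  le : a ≤ b
  lt : ∀ i, l i < r i
  subset : ∀ i, Set.Ioo (l i) (r i) ⊆ Set.Icc a b
  disjoint : Pairwise fun i j => Disjoint (Set.Ioo (l i) (r i)) (Set.Ioo (l j) (r j))
  eq_diff : A = Set.Icc a b \ ⋃ i, Set.Ioo (l i) (r i)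

/-- The ternary Cantor set of length `ℓ`: the standard one in `[0, 1]`, scaled to `[0, ℓ]`. -/
def cantorSetOfLength (ℓ : ℝ) : Set ℝ := (fun x => ℓ * x) '' cantorSet

end MetricMagnitude

/-!
Finite sets of reals are treated by adding points from left to right, using that
`exp (-(z - x)) = exp (-(y - x)) * exp (-(z - y))` for `x ≤ y ≤ z`. The quadratic form of
`exp (-d)` on a finite set dominates the square of the potential to the right of the set, and this
survives the addition of a point (`sq_sum_lt_quadratic`); so every subset of the line is positive
definite. Likewise, adding a point `M` to the right of the largest point `p` of a finite set
changes a weighting only at `p` and `M`, and increases the magnitude by `tanh ((M - p) / 2)`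
(`MatrixHasMagnitude.insert_max`). Hence points `x₀ < ... < xₙ` have magnitude
`1 + ∑ tanh ((xᵢ₊₁ - xᵢ) / 2)`.

For compact `A` with a given decomposition, let `cumulative A l r t` be the claimed contribution to
the magnitude of the part of `A` to the left of `t`. Between two points `x < y` of `A`, the length
`y - x` is the length of `A` there plus the lengths of the gaps there. Since `tanh` is subadditive
on the half-line and at most the identity, `tanh ((y - x) / 2)` is at most the increment of
`cumulative` (`tanh_le_cumulative_sub`), which bounds the magnitude of all finite subsets from
above. Conversely, equality holds if `x` and `y` bound a gap (`cumulative_sub_of_gap`), and for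
`y - x ≤ ε` the difference is at most `ε * (y - x)`. As `A` has finite subsets
whose consecutive points are of these two kinds (`exists_finset_magnitude_ge`), the bound is the
supremum.

The gaps of the ternary Cantor set are indexed by finite binary words, with `2 ^ n` gaps of length
`1 / 3 ^ (n + 1)` for the words of length `n`, and the Cantor set has volume zero; the formula for
it is the general one, summed first over the words of each length.
-/

namespace MetricMagnitude

open Finset Matrix

/-! ### The hyperbolic tangent on the half-line -/

theorem tanh_half_eq (s : ℝ) :
    Real.tanh (s / 2) = (1 - Real.exp (-s)) / (1 + Real.exp (-s)) := by
  have h : Real.exp (-s) = Real.exp (-(s / 2)) * Real.exp (-(s / 2)) := by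
    rw [← Real.exp_add]; ring_nf
  have h' : Real.exp (s / 2) * Real.exp (-(s / 2)) = 1 := by
    rw [← Real.exp_add]; simp
  have := Real.exp_pos (s / 2)
  have := Real.exp_pos (-(s / 2))
  rw [Real.tanh_eq, h, div_eq_div_iff (by positivity) (by positivity)]
  linear_combination (2 * Real.exp (-(s / 2))) * h'

theorem tanh_half_nonneg {s : ℝ} (hs : 0 ≤ s) : 0 ≤ Real.tanh (s / 2) := by
  rw [tanh_half_eq]
  have : Real.exp (-s) ≤ 1 := Real.exp_le_one_iff.mpr (by linarith)
  exact div_nonneg (by linarith) (by positivity)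

/-- On the half-line, `s ↦ tanh (s / 2)` is subadditive. -/
theorem tanh_half_add_le {s t : ℝ} (hs : 0 ≤ s) (ht : 0 ≤ t) :
    Real.tanh ((s + t) / 2) ≤ Real.tanh (s / 2) + Real.tanh (t / 2) := by
  simp only [tanh_half_eq]
  have h : Real.exp (-(s + t)) = Real.exp (-s) * Real.exp (-t) := by
    rw [← Real.exp_add]; ring_nf
  have hs1 : Real.exp (-s) ≤ 1 := Real.exp_le_one_iff.mpr (by linarith)
  have ht1 : Real.exp (-t) ≤ 1 := Real.exp_le_one_iff.mpr (by linarith)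
  have hs0 := Real.exp_pos (-s)
  have ht0 := Real.exp_pos (-t)
  rw [h]
  generalize Real.exp (-s) = a at *
  generalize Real.exp (-t) = b at *
  rw [div_add_div _ _ (by positivity) (by positivity), div_le_div_iff₀ (by positivity)
    (by positivity)]
  have hab : 0 ≤ 1 - a * b := by nlinarith
  nlinarith [mul_nonneg hab (mul_nonneg (sub_nonneg.2 hs1) (sub_nonneg.2 ht1))]

theorem tanh_le_self {u : ℝ} (hu : 0 ≤ u) : Real.tanh u ≤ u := by
  have hmono : MonotoneOn (fun x => x * Real.cosh x - Real.sinh x) (Set.Ici 0) := by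
    have hd : ∀ x : ℝ, HasDerivAt (fun x => x * Real.cosh x - Real.sinh x)
        (x * Real.sinh x) x := fun x => by
      have := ((hasDerivAt_id x).mul (Real.hasDerivAt_cosh x)).sub (Real.hasDerivAt_sinh x)
      refine this.congr_deriv ?_
      simp only [id_eq, one_mul]
      ring
    refine monotoneOn_of_deriv_nonneg (convex_Ici 0)
      (fun x _ => (hd x).continuousAt.continuousWithinAt)
      (fun x _ => (hd x).differentiableAt.differentiableWithinAt) fun x hx => ?_
    rw [(hd x).deriv]
    rw [interior_Ici] at hx
    exact mul_nonneg hx.le (Real.sinh_nonneg_iff.2 hx.le)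
  have h := hmono (Set.mem_Ici.2 le_rfl) (Set.mem_Ici.2 hu) hu
  simp only [zero_mul, Real.sinh_zero, sub_zero, sub_nonneg] at h
  rwa [Real.tanh_eq_sinh_div_cosh, div_le_iff₀ (Real.cosh_pos u)]

/-- The bound `u - u ^ 2 ≤ tanh u` at `u = s / 2`, from `exp (-s) ≤ 1 / (1 + s)`. -/
theorem sub_sq_le_tanh_half {s : ℝ} (hs : 0 ≤ s) : s / 2 - s ^ 2 / 4 ≤ Real.tanh (s / 2) := by
  rw [tanh_half_eq]
  have h0 := Real.exp_pos (-s)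
  have h1 : Real.exp (-s) * (1 + s) ≤ 1 := by
    calc Real.exp (-s) * (1 + s) ≤ Real.exp (-s) * Real.exp s := by
          gcongr; linarith [Real.add_one_le_exp s]
      _ = 1 := by rw [← Real.exp_add]; simp
  generalize Real.exp (-s) = a at *
  rw [le_div_iff₀ (by positivity)]
  have h3 : a ≤ 1 / (1 + s) := by rw [le_div_iff₀ (by positivity)]; exact h1
  have h4 : (s / 2 - s ^ 2 / 4) * (1 + s + 1) ≤ s := by nlinarith [pow_nonneg hs 3]
  rcases le_or_gt (s / 2 - s ^ 2 / 4) 0 with h5 | h5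
  · have : a ≤ 1 := by nlinarith
    nlinarith
  · have h6 : 0 < 1 + (s / 2 - s ^ 2 / 4) := by linarith
    have h7 : a * (1 + (s / 2 - s ^ 2 / 4)) ≤ 1 / (1 + s) * (1 + (s / 2 - s ^ 2 / 4)) := by gcongr
    have h8 : 1 / (1 + s) * (1 + (s / 2 - s ^ 2 / 4)) ≤ 1 - (s / 2 - s ^ 2 / 4) := by
      rw [one_div, inv_mul_le_iff₀ (by positivity)]; linarith
    linarith

theorem continuous_tanh : Continuous Real.tanh := by
  have : Real.tanh = fun x => Real.sinh x / Real.cosh x :=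
    funext Real.tanh_eq_sinh_div_cosh
  rw [this]
  exact Real.continuous_sinh.div Real.continuous_cosh fun x => (Real.cosh_pos x).ne'

/-! ### Positive definiteness of finite sets of reals -/

theorem exp_neg_dist_of_le {x y : ℝ} (h : x ≤ y) : Real.exp (-dist x y) = Real.exp (-(y - x)) := by
  rw [Real.dist_eq, abs_sub_comm, abs_of_nonneg (by linarith)]

/-- The sum of `exp (-d(t, x)) * c x` over points `x ≤ M ≤ t` of `B` decays exponentially in `t`. -/
theorem sum_exp_neg_dist_of_le {B : Finset ℝ} {M t : ℝ} (hB : ∀ x ∈ B, x ≤ M) (hM : M ≤ t)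
    (c : ℝ → ℝ) :
    ∑ x ∈ B, Real.exp (-dist t x) * c x =
      Real.exp (-(t - M)) * ∑ x ∈ B, Real.exp (-dist M x) * c x := by
  rw [Finset.mul_sum]
  refine Finset.sum_congr rfl fun x hx => ?_
  rw [dist_comm t, dist_comm M, exp_neg_dist_of_le (hB x hx),
    exp_neg_dist_of_le ((hB x hx).trans hM), ← mul_assoc, ← Real.exp_add]
  ring_nf

/-- The quadratic form of `exp (-d)` when a point `M` is added. -/
theorem sum_insert_quadratic {B : Finset ℝ} {M : ℝ} (hM : M ∉ B) (c : ℝ → ℝ) :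
    ∑ x ∈ insert M B, ∑ y ∈ insert M B, c x * (Real.exp (-dist x y) * c y) =
      ∑ x ∈ B, ∑ y ∈ B, c x * (Real.exp (-dist x y) * c y) +
        2 * c M * ∑ y ∈ B, Real.exp (-dist M y) * c y + c M ^ 2 := by
  simp only [Finset.sum_insert hM, Finset.sum_add_distrib, ← Finset.mul_sum, dist_self, neg_zero,
    Real.exp_zero]
  have : ∑ x ∈ B, c x * (Real.exp (-dist x M) * c M) =
      c M * ∑ y ∈ B, Real.exp (-dist M y) * c y := by
    rw [Finset.mul_sum]
    refine Finset.sum_congr rfl fun x _ => ?_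
    rw [dist_comm]; ring
  rw [this]; ring

/-- The quadratic form of `exp (-d)` on a finite set of reals is strictly larger than the square of
the potential at any point to the right. This strengthening of positive definiteness is stable
under adding a new largest point. -/
theorem sq_sum_lt_quadratic (B : Finset ℝ) (c : ℝ → ℝ) :
    (∃ x ∈ B, c x ≠ 0) → ∀ t, (∀ x ∈ B, x < t) →
      (∑ y ∈ B, Real.exp (-dist t y) * c y) ^ 2 <
        ∑ x ∈ B, ∑ y ∈ B, c x * (Real.exp (-dist x y) * c y) := by
  induction B using Finset.induction_on_max with
  | empty => simp
  | insert M B hM ih =>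
    intro hc t ht
    have hMB : M ∉ B := fun h => lt_irrefl _ (hM M h)
    have hMt : M < t := ht M (Finset.mem_insert_self _ _)
    rw [sum_insert_quadratic hMB, sum_exp_neg_dist_of_le (M := M) _ hMt.le,
      Finset.sum_insert hMB, dist_self, neg_zero, Real.exp_zero, one_mul]
    · set S := ∑ y ∈ B, Real.exp (-dist M y) * c y with hS
      set Q := ∑ x ∈ B, ∑ y ∈ B, c x * (Real.exp (-dist x y) * c y) with hQ
      have he : Real.exp (-(t - M)) < 1 := Real.exp_lt_one_iff.2 (by linarith)
      have he0 := Real.exp_pos (-(t - M))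
      have he2 : Real.exp (-(t - M)) ^ 2 < 1 := by nlinarith
      rw [mul_pow]
      by_cases hcB : ∃ x ∈ B, c x ≠ 0
      · have h1 := ih hcB M hM
        nlinarith [sq_nonneg (c M + S)]
      · push Not at hcB
        have hS0 : S = 0 := Finset.sum_eq_zero fun x hx => by rw [hcB x hx, mul_zero]
        have hQ0 : Q = 0 := Finset.sum_eq_zero fun x hx =>
          Finset.sum_eq_zero fun y _ => by rw [hcB x hx, zero_mul]
        have hcM : c M ≠ 0 := by
          obtain ⟨x, hx, hx0⟩ := hc
          rcases Finset.mem_insert.1 hx with rfl | hx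
          · exact hx0
          · exact absurd (hcB x hx) hx0
        have : 0 < c M ^ 2 := by positivity
        rw [hS0, hQ0]
        nlinarith
    · intro x hx
      rcases Finset.mem_insert.1 hx with rfl | hx
      · exact le_rfl
      · exact (hM x hx).le

theorem posDef_similarityMatrix (B : Finset ℝ) : (similarityMatrix B).PosDef := by
  refine Matrix.PosDef.of_dotProduct_mulVec_pos ?_ fun x hx => ?_
  · ext i j
    simp [similarityMatrix, dist_comm]
  · set c : ℝ → ℝ := fun t => if h : t ∈ B then x ⟨t, h⟩ else 0 with hc
    have hcx : ∀ i : B, x i = c i := fun i => by simp [hc]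
    obtain ⟨i, hi⟩ := Function.ne_iff.1 hx
    obtain ⟨t, ht⟩ : ∃ t, ∀ x ∈ B, x < t := by
      obtain ⟨t, ht⟩ := B.exists_le
      exact ⟨t + 1, fun x hx => (ht x hx).trans_lt (lt_add_one t)⟩
    have h := sq_sum_lt_quadratic B c ⟨i, i.2, by rw [← hcx]; exact hi⟩ t ht
    have h' := (sq_nonneg _).trans_lt h
    simp only [star_trivial, dotProduct, mulVec, hcx, similarityMatrix, Matrix.of_apply,
      Finset.mul_sum]
    rw [← Finset.sum_coe_sort] at h'
    simpa only [← Finset.sum_coe_sort B] using h'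

theorem isPositiveDefinite_real (A : Set ℝ) : IsPositiveDefinite A :=
  fun B _ => posDef_similarityMatrix B

/-! ### Magnitude of finite sets of reals -/

theorem MatrixHasMagnitude.unique {ι : Type*} [Fintype ι] {Z : Matrix ι ι ℝ} {m m' : ℝ}
    (h : MatrixHasMagnitude Z m) (h' : MatrixHasMagnitude Z m') : m = m' := by
  obtain ⟨w, v, hw, hv, rfl⟩ := h
  obtain ⟨w', v', hw', hv', rfl⟩ := h'
  have key : ∀ u : ι → ℝ, IsWeighting Z u → ∑ i, u i = ∑ i, v i := fun u hu => by
    have h := Matrix.dotProduct_mulVec v Z u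
    rw [hu, hv] at h
    simpa only [one_dotProduct, dotProduct_one] using h.symm
  rw [key w hw, key w' hw']

/-- A weighting is also a coweighting, since the similarity matrix is symmetric. -/
theorem matrixHasMagnitude_similarityMatrix {B : Finset ℝ} {w : ℝ → ℝ}
    (hw : ∀ x ∈ B, ∑ y ∈ B, Real.exp (-dist x y) * w y = 1) :
    MatrixHasMagnitude (similarityMatrix B) (∑ x ∈ B, w x) := by
  refine ⟨fun i => w i, fun i => w i, ?_, ?_, Finset.sum_coe_sort B w⟩
  · ext i
    simpa [mulVec, dotProduct, similarityMatrix, ← Finset.sum_coe_sort B] using hw i i.2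
  · ext i
    have := hw i i.2
    rw [← Finset.sum_coe_sort B] at this
    simpa [vecMul, dotProduct, similarityMatrix, dist_comm, mul_comm] using this

theorem matrixHasMagnitude_empty : MatrixHasMagnitude (similarityMatrix (∅ : Finset ℝ)) 0 := by
  simpa using matrixHasMagnitude_similarityMatrix (B := ∅) (w := 0) (by simp)

theorem matrixHasMagnitude_singleton (x : ℝ) :
    MatrixHasMagnitude (similarityMatrix ({x} : Finset ℝ)) 1 := by
  simpa using matrixHasMagnitude_similarityMatrix (B := {x}) (w := 1) (by simp)

/-- Adding a point `M` to the right of the largest point `p` of a finite set of reals increases the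
magnitude by `tanh ((M - p) / 2)`. -/
theorem MatrixHasMagnitude.insert_max {B : Finset ℝ} {p M m : ℝ}
    (hm : MatrixHasMagnitude (similarityMatrix B) m) (hp : IsGreatest (B : Set ℝ) p)
    (hM : p < M) :
    MatrixHasMagnitude (similarityMatrix (insert M B)) (m + Real.tanh ((M - p) / 2)) := by
  obtain ⟨w, v, hw, hv, rfl⟩ := hm
  have hMB : M ∉ B := fun h => (hp.2 h).not_gt hM
  have hpB : p ∈ B := hp.1
  set u : ℝ → ℝ := fun t => if h : t ∈ B then w ⟨t, h⟩ else 0 with hu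
  have hwu : ∀ i : B, w i = u i := fun i => by simp [hu]
  have hu1 : ∀ x ∈ B, ∑ y ∈ B, Real.exp (-dist x y) * u y = 1 := fun x hx => by
    have h := congrFun hw ⟨x, hx⟩
    simp only [mulVec, dotProduct, similarityMatrix, Matrix.of_apply, hwu, Pi.one_apply] at h
    rwa [Finset.sum_coe_sort B fun y => Real.exp (-dist x y) * u y] at h
  set e := Real.exp (-(M - p)) with he
  have he0 : 0 < e := Real.exp_pos _
  -- The signed measure `δ_M - e δ_p` has zero potential at every point of `B`; the multiple
  -- `c` of it is what corrects the potential at `M` from `e` to `1`.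
  set c := 1 / (1 + e) with hc
  set w' : ℝ → ℝ := fun t => if t = M then c else u t - (if t = p then c * e else 0) with hw'
  have hw'M : w' M = c := by simp [hw']
  have hw'B : ∀ t ∈ B, w' t = u t - (if t = p then c * e else 0) := fun t ht => by
    have : t ≠ M := fun h => hMB (h ▸ ht)
    simp [hw', this]
  have hpot : ∀ x, ∑ y ∈ insert M B, Real.exp (-dist x y) * w' y =
      Real.exp (-dist x M) * c + (∑ y ∈ B, Real.exp (-dist x y) * u y
        - Real.exp (-dist x p) * (c * e)) := fun x => by
    rw [Finset.sum_insert hMB, hw'M]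
    congr 1
    rw [Finset.sum_congr rfl fun y hy => by rw [hw'B y hy, mul_sub], Finset.sum_sub_distrib]
    simp [hpB]
  have hsum : ∑ x ∈ insert M B, w' x = ∑ i, w i + Real.tanh ((M - p) / 2) := by
    rw [Finset.sum_insert hMB, hw'M, Finset.sum_congr rfl hw'B, Finset.sum_sub_distrib,
      Finset.sum_congr rfl fun i _ => hwu i, Finset.sum_coe_sort B u, tanh_half_eq, ← he]
    simp only [Finset.sum_ite_eq', hpB, if_true, hc]
    field_simp
    ring
  rw [← hsum]
  refine matrixHasMagnitude_similarityMatrix fun x hx => ?_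
  rw [hpot]
  rcases Finset.mem_insert.1 hx with rfl | hx
  · rw [sum_exp_neg_dist_of_le (M := p) (fun y hy => hp.2 hy) hM.le, hu1 p hpB, dist_comm x p,
      exp_neg_dist_of_le hM.le, ← he, dist_self, neg_zero, Real.exp_zero]
    simp only [hc]
    field_simp
    ring
  · have hxp : x ≤ p := hp.2 hx
    have : Real.exp (-dist x M) = Real.exp (-dist x p) * e := by
      rw [exp_neg_dist_of_le hxp, exp_neg_dist_of_le (hxp.trans hM.le), he, ← Real.exp_add]
      ring_nf
    rw [hu1 x hx, this]
    ring

/-- If `G` dominates the increments of the magnitude along `A`, then `1 + G` bounds the magnitude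
of every finite subset of `A`. -/
theorem exists_magnitude_le {A : Set ℝ} {G : ℝ → ℝ} (hG0 : ∀ x ∈ A, 0 ≤ G x)
    (hG : ∀ x ∈ A, ∀ y ∈ A, x < y → Real.tanh ((y - x) / 2) ≤ G y - G x) (B : Finset ℝ) :
    (B : Set ℝ) ⊆ A → ∃ m, MatrixHasMagnitude (similarityMatrix B) m ∧
      ∀ p, IsGreatest (B : Set ℝ) p → m ≤ 1 + G p := by
  induction B using Finset.induction_on_max with
  | empty => exact fun _ => ⟨0, matrixHasMagnitude_empty, fun p hp => by simpa using hp.1⟩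
  | insert M B hM ih =>
    intro hBA
    rw [Finset.coe_insert, Set.insert_subset_iff] at hBA
    have hmax : ∀ p, IsGreatest ((insert M B : Finset ℝ) : Set ℝ) p → p = M := fun p hp =>
      hp.unique ⟨by simp, fun x hx => by
        rcases Finset.mem_insert.1 hx with rfl | hx
        · exact le_rfl
        · exact (hM x hx).le⟩
    rcases B.eq_empty_or_nonempty with rfl | hne
    · exact ⟨1, matrixHasMagnitude_singleton M, fun p hp => by
        rw [hmax p hp]; linarith [hG0 M hBA.1]⟩
    · obtain ⟨m, hm, hmG⟩ := ih hBA.2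
      have hp := B.isGreatest_max' hne
      have hpM := hM _ hp.1
      refine ⟨_, hm.insert_max hp hpM, fun q hq => ?_⟩
      rw [hmax q hq]
      linarith [hmG _ hp, hG _ (hBA.2 hp.1) M hBA.1 hpM]

end MetricMagnitude

namespace MetricMagnitude

open MeasureTheory Filter Topology

/-! ### Gap decompositions -/

theorem exists_isGapDecomposition {A : Set ℝ} (hA : IsCompact A) (hne : A.Nonempty) :
    ∃ (ι : Type) (a b : ℝ) (l r : ι → ℝ), Countable ι ∧ IsGapDecomposition A a b l r := by
  -- The gaps are the pairs of points of `A` with no point of `A` strictly between them.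
  set ι := {p : ℝ × ℝ // p.1 ∈ A ∧ p.2 ∈ A ∧ p.1 < p.2 ∧ ∀ z ∈ Set.Ioo p.1 p.2, z ∉ A}
  have hdisj : Pairwise fun i j : ι =>
      Disjoint (Set.Ioo i.1.1 i.1.2) (Set.Ioo j.1.1 j.1.2) := by
    rintro ⟨⟨l, r⟩, hl, hr, hlt, hgap⟩ ⟨⟨l', r'⟩, hl', hr', hlt', hgap'⟩ hij
    refine Set.disjoint_left.2 fun z hz hz' => hij ?_
    simp only [Set.mem_Ioo] at *
    have h1 : l = l' := le_antisymm
      (not_lt.1 fun h => hgap' l ⟨h, hz.1.trans hz'.2⟩ hl)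
      (not_lt.1 fun h => hgap l' ⟨h, hz'.1.trans hz.2⟩ hl')
    have h2 : r = r' := le_antisymm
      (not_lt.1 fun h => hgap r' ⟨hz.1.trans hz'.2, h⟩ hr')
      (not_lt.1 fun h => hgap' r ⟨hz'.1.trans hz.2, h⟩ hr)
    simp [h1, h2]
  have ha := hA.isLeast_sInf hne
  have hb := hA.isGreatest_sSup hne
  refine ⟨ι, sInf A, sSup A, fun i => i.1.1, fun i => i.1.2, ?_, ha.2 hb.1, fun i => i.2.2.2.1,
    fun i z hz => ⟨(ha.2 i.2.1).trans hz.1.le, hz.2.le.trans (hb.2 i.2.2.1)⟩, hdisj, ?_⟩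
  · exact hdisj.countable_of_isOpen_disjoint (fun _ => isOpen_Ioo)
      fun i => Set.nonempty_Ioo.2 i.2.2.2.1
  · ext x
    simp only [Set.mem_sdiff, Set.mem_iUnion, not_exists]
    refine ⟨fun hx => ⟨⟨ha.2 hx, hb.2 hx⟩, fun i hi => i.2.2.2.2 x hi hx⟩, fun ⟨hx, hgap⟩ => ?_⟩
    by_contra hxA
    obtain ⟨l, hl⟩ := (hA.inter_right isClosed_Iic).exists_isGreatest ⟨sInf A, ha.1, hx.1⟩
    obtain ⟨r, hr⟩ := (hA.inter_right isClosed_Ici).exists_isLeast ⟨sSup A, hb.1, hx.2⟩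
    have hlx : l < x := lt_of_le_of_ne hl.1.2 fun h => hxA (h ▸ hl.1.1)
    have hxr : x < r := lt_of_le_of_ne hr.1.2 fun h => hxA (h ▸ hr.1.1)
    refine hgap ⟨(l, r), hl.1.1, hr.1.1, hlx.trans hxr, fun z hz hzA => ?_⟩ ⟨hlx, hxr⟩
    rcases le_total z x with h | h
    · exact (hl.2 ⟨hzA, h⟩).not_gt hz.1
    · exact (hr.2 ⟨hzA, h⟩).not_gt hz.2

/-- Half the length of `A` to the left of `t`, plus the contribution `tanh (s / 2)` of every gap of
length `s` to the left of `t`. For `t` to the right of the least point of `A`,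
the magnitude of `A ∩ (-∞, t]` turns out to be `1` more. -/
noncomputable def cumulative (A : Set ℝ) {ι : Type*} (l r : ι → ℝ) (t : ℝ) : ℝ :=
  volume.real (A ∩ Set.Iic t) / 2 + ∑' i, if r i ≤ t then Real.tanh ((r i - l i) / 2) else 0

namespace IsGapDecomposition

variable {A : Set ℝ} {a b : ℝ} {ι : Type*} {l r : ι → ℝ}

/-- Closed gaps still lie in `[a, b]`. -/
theorem Icc_subset (h : IsGapDecomposition A a b l r) (i : ι) :
    Set.Icc (l i) (r i) ⊆ Set.Icc a b := by
  rw [← closure_Ioo (h.lt i).ne]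
  exact closure_minimal (h.subset i) isClosed_Icc

theorem mem_iff (h : IsGapDecomposition A a b l r) {x : ℝ} :
    x ∈ A ↔ x ∈ Set.Icc a b ∧ ∀ i, x ∉ Set.Ioo (l i) (r i) := by
  rw [h.eq_diff]; simp

theorem eq_of_max_lt_min (h : IsGapDecomposition A a b l r) {i j : ι}
    (hlt : max (l i) (l j) < min (r i) (r j)) : i = j := by
  by_contra hij
  exact (Set.Ioo_disjoint_Ioo.1 (h.disjoint hij)).not_gt hlt

theorem le_or_le (h : IsGapDecomposition A a b l r) {x : ℝ} (hx : x ∈ A) (i : ι) :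
    x ≤ l i ∨ r i ≤ x := by
  have := (h.mem_iff.1 hx).2 i
  simpa [Set.mem_Ioo, or_iff_not_imp_left] using this

theorem left_mem (h : IsGapDecomposition A a b l r) (i : ι) : l i ∈ A := by
  refine h.mem_iff.2 ⟨h.Icc_subset i (Set.left_mem_Icc.2 (h.lt i).le), fun j hj => ?_⟩
  have hij : i = j := h.eq_of_max_lt_min
    (max_lt (lt_min (h.lt i) hj.2) (lt_min (hj.1.trans (h.lt i)) (h.lt j)))
  subst hij
  exact lt_irrefl _ hj.1

theorem right_mem (h : IsGapDecomposition A a b l r) (i : ι) : r i ∈ A := by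
  refine h.mem_iff.2 ⟨h.Icc_subset i (Set.right_mem_Icc.2 (h.lt i).le), fun j hj => ?_⟩
  have hij : i = j := h.eq_of_max_lt_min
    (max_lt (lt_min (h.lt i) ((h.lt i).trans hj.2)) (lt_min hj.1 (h.lt j)))
  subst hij
  exact lt_irrefl _ hj.2

theorem isLeast (h : IsGapDecomposition A a b l r) : IsLeast A a := by
  refine ⟨h.mem_iff.2 ⟨Set.left_mem_Icc.2 h.le, fun i hi => ?_⟩, fun x hx => (h.mem_iff.1 hx).1.1⟩
  exact (h.mem_iff.1 (h.left_mem i)).1.1.not_gt hi.1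

theorem isGreatest (h : IsGapDecomposition A a b l r) : IsGreatest A b := by
  refine ⟨h.mem_iff.2 ⟨Set.right_mem_Icc.2 h.le, fun i hi => ?_⟩,
    fun x hx => (h.mem_iff.1 hx).1.2⟩
  exact (h.mem_iff.1 (h.right_mem i)).1.2.not_gt hi.2

/-- Between two points `x ≤ y` of `A`, the gaps fill exactly what `A` leaves of the length. -/
theorem hasSum_length [Countable ι] (h : IsGapDecomposition A a b l r) {x y : ℝ}
    (hx : x ∈ A) (hy : y ∈ A) (hxy : x ≤ y) :
    HasSum (fun i => if r i ∈ Set.Ioc x y then r i - l i else 0)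
      (y - x - volume.real (A ∩ Set.Ioc x y)) := by
  set T : ι → Set ℝ := fun i => if r i ∈ Set.Ioc x y then Set.Ioo (l i) (r i) else ∅ with hT
  have hTm : ∀ i, MeasurableSet (T i) := fun i => by
    simp only [hT]; split_ifs
    exacts [measurableSet_Ioo, MeasurableSet.empty]
  have hTd : Pairwise (Function.onFun Disjoint T) := fun i j hij => by
    simp only [hT, Function.onFun]
    split_ifs
    exacts [h.disjoint hij, by simp, by simp, by simp]
  have hTU : Set.Ioc x y \ A = ⋃ i, T i := by
    ext z
    simp only [Set.mem_sdiff, Set.mem_iUnion]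
    constructor
    · rintro ⟨hz, hzA⟩
      obtain ⟨i, hi⟩ : ∃ i, z ∈ Set.Ioo (l i) (r i) := by
        by_contra hno
        push Not at hno
        exact hzA (h.mem_iff.2 ⟨⟨(h.isLeast.2 hx).trans hz.1.le, hz.2.trans (h.isGreatest.2 hy)⟩,
          hno⟩)
      refine ⟨i, ?_⟩
      have : r i ∈ Set.Ioc x y := ⟨hz.1.trans hi.2,
        (h.le_or_le hy i).resolve_left (by linarith [hi.1, hz.2])⟩
      simp only [hT, if_pos this]
      exact hi
    · rintro ⟨i, hi⟩
      simp only [hT] at hi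
      split_ifs at hi with hr
      · refine ⟨⟨?_, hi.2.le.trans hr.2⟩, fun hzA => (h.mem_iff.1 hzA).2 i hi⟩
        exact ((h.le_or_le hx i).resolve_right (not_le.2 hr.1)).trans_lt hi.1
      · exact absurd hi (Set.notMem_empty _)
  have hAm : MeasurableSet A := by
    rw [h.eq_diff]
    exact measurableSet_Icc.diff (MeasurableSet.iUnion fun _ => measurableSet_Ioo)
  have hvol : volume.real (⋃ i, T i) = y - x - volume.real (A ∩ Set.Ioc x y) := by
    have := measureReal_sdiff_add_inter (μ := volume) (s := Set.Ioc x y) hAm (by simp)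
    rw [← hTU, Set.inter_comm A]
    rw [Real.volume_real_Ioc_of_le hxy] at this
    linarith
  have hU : volume (⋃ i, T i) = ∑' i, volume (T i) := measure_iUnion hTd hTm
  have hfin : ∑' i, volume (T i) ≠ ⊤ := by
    rw [← hU, ← hTU]
    exact measure_ne_top_of_subset Set.sdiff_subset (by simp)
  have hsum := ENNReal.hasSum_toReal hfin
  rw [← ENNReal.tsum_toReal_eq fun i => ENNReal.ne_top_of_tsum_ne_top hfin i, ← hU] at hsum
  rw [← hvol, measureReal_def]
  convert hsum using 1
  funext i
  simp only [hT]
  split_ifs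
  · rw [Real.volume_Ioo, ENNReal.toReal_ofReal (sub_nonneg.2 (h.lt i).le)]
  · simp

theorem right_mem_Ioc (h : IsGapDecomposition A a b l r) (i : ι) : r i ∈ Set.Ioc a b :=
  ⟨(h.isLeast.2 (h.left_mem i)).trans_lt (h.lt i), h.isGreatest.2 (h.right_mem i)⟩

theorem summable_tanh [Countable ι] (h : IsGapDecomposition A a b l r) :
    Summable fun i => Real.tanh ((r i - l i) / 2) := by
  have hs := (h.hasSum_length h.isLeast.1 h.isGreatest.1 h.le).summable
  simp only [h.right_mem_Ioc, if_true] at hs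
  have hpos : ∀ i, 0 ≤ r i - l i := fun i => sub_nonneg.2 (h.lt i).le
  exact (hs.div_const 2).of_nonneg_of_le (fun i => tanh_half_nonneg (hpos i))
    fun i => tanh_le_self (div_nonneg (hpos i) zero_le_two)

theorem summable_ite_tanh [Countable ι] (h : IsGapDecomposition A a b l r) (p : ι → Prop)
    [DecidablePred p] : Summable fun i => if p i then Real.tanh ((r i - l i) / 2) else 0 := by
  have h0 : ∀ i, 0 ≤ Real.tanh ((r i - l i) / 2) := fun i =>
    tanh_half_nonneg (sub_nonneg.2 (h.lt i).le)
  refine h.summable_tanh.of_nonneg_of_le (fun i => ?_) fun i => ?_ <;> split_ifs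
  exacts [h0 i, le_rfl, le_rfl, h0 i]

theorem volume_ne_top (h : IsGapDecomposition A a b l r) : volume A ≠ ⊤ :=
  measure_ne_top_of_subset (fun _ hx => (h.mem_iff.1 hx).1) (measure_Icc_lt_top (a := a) (b := b)).ne

theorem cumulative_sub [Countable ι] (h : IsGapDecomposition A a b l r) {x y : ℝ} (hxy : x ≤ y) :
    cumulative A l r y - cumulative A l r x = volume.real (A ∩ Set.Ioc x y) / 2 +
      ∑' i, if r i ∈ Set.Ioc x y then Real.tanh ((r i - l i) / 2) else 0 := by
  have hfin : ∀ s, volume (A ∩ s) ≠ ⊤ := fun s =>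
    measure_ne_top_of_subset Set.inter_subset_left h.volume_ne_top
  have hvol : volume.real (A ∩ Set.Iic y) =
      volume.real (A ∩ Set.Iic x) + volume.real (A ∩ Set.Ioc x y) := by
    have h1 := measureReal_sdiff_add_inter (μ := volume) (s := A ∩ Set.Iic y)
      (measurableSet_Iic (a := x)) (hfin _)
    have h2 : (A ∩ Set.Iic y) \ Set.Iic x = A ∩ Set.Ioc x y := by ext z; simp; tauto
    have h3 : A ∩ Set.Iic y ∩ Set.Iic x = A ∩ Set.Iic x := by
      ext z; simp only [Set.mem_inter_iff, Set.mem_Iic]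
      exact ⟨fun hz => ⟨hz.1.1, hz.2⟩, fun hz => ⟨⟨hz.1, hz.2.trans hxy⟩, hz.2⟩⟩
    rw [h2, h3] at h1
    linarith
  have hsum : (∑' i, if r i ≤ y then Real.tanh ((r i - l i) / 2) else 0) =
      (∑' i, if r i ≤ x then Real.tanh ((r i - l i) / 2) else 0) +
      ∑' i, if r i ∈ Set.Ioc x y then Real.tanh ((r i - l i) / 2) else 0 := by
    rw [← (h.summable_ite_tanh _).tsum_add (h.summable_ite_tanh _)]
    refine tsum_congr fun i => ?_
    by_cases h1 : r i ≤ x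
    · simp [h1, h1.trans hxy, not_lt.2 h1]
    · simp [h1, not_le.1 h1]
  simp only [cumulative, hvol, hsum]
  ring

theorem cumulative_nonneg (h : IsGapDecomposition A a b l r) (t : ℝ) :
    0 ≤ cumulative A l r t := by
  refine add_nonneg (by positivity) (tsum_nonneg fun i => ?_)
  split_ifs
  exacts [tanh_half_nonneg (sub_nonneg.2 (h.lt i).le), le_rfl]

theorem cumulative_left (h : IsGapDecomposition A a b l r) : cumulative A l r a = 0 := by
  have hv : volume.real (A ∩ Set.Iic a) = 0 :=
    measureReal_mono_null (s₂ := {a}) (fun x hx => le_antisymm hx.2 (h.isLeast.2 hx.1))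
      (by simp [measureReal_def]) (by simp)
  simp [cumulative, hv, fun i => not_le.2 (h.right_mem_Ioc i).1]

theorem cumulative_right (h : IsGapDecomposition A a b l r) :
    cumulative A l r b = volume.real A / 2 + ∑' i, Real.tanh ((r i - l i) / 2) := by
  have hA : A ∩ Set.Iic b = A := Set.inter_eq_left.2 fun x hx => h.isGreatest.2 hx
  simp [cumulative, hA, fun i => (h.right_mem_Ioc i).2]

theorem ite_length_nonneg (h : IsGapDecomposition A a b l r) (x y : ℝ) (i : ι) :
    0 ≤ if r i ∈ Set.Ioc x y then r i - l i else 0 := by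
  split_ifs
  exacts [sub_nonneg.2 (h.lt i).le, le_rfl]

/-- The hyperbolic tangent of half of the length `y - x` is at most the increment of `cumulative`:
`y - x` is the sum of the length of `A` and the lengths of the gaps between `x` and `y`, so this is
the subadditivity of `tanh`, passed to the limit over finite sets of gaps. -/
theorem tanh_le_cumulative_sub [Countable ι] (h : IsGapDecomposition A a b l r) {x y : ℝ}
    (hx : x ∈ A) (hy : y ∈ A) (hxy : x ≤ y) :
    Real.tanh ((y - x) / 2) ≤ cumulative A l r y - cumulative A l r x := by
  have hsum := h.hasSum_length hx hy hxy
  have hs := h.summable_ite_tanh fun i => r i ∈ Set.Ioc x y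
  rw [h.cumulative_sub hxy]
  set v := volume.real (A ∩ Set.Ioc x y) with hv
  have hv0 : 0 ≤ v := measureReal_nonneg
  have hF : ∀ F : Finset ι,
      Real.tanh ((v + ∑ i ∈ F, if r i ∈ Set.Ioc x y then r i - l i else 0) / 2) ≤
        v / 2 + ∑ i ∈ F, if r i ∈ Set.Ioc x y then Real.tanh ((r i - l i) / 2) else 0 := by
    classical
    intro F
    induction F using Finset.induction_on with
    | empty => simpa using tanh_le_self (div_nonneg hv0 zero_le_two)
    | insert i F hi ih =>
      rw [Finset.sum_insert hi, Finset.sum_insert hi, add_left_comm]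
      have h1 := tanh_half_add_le (h.ite_length_nonneg x y i)
        (add_nonneg hv0 (Finset.sum_nonneg fun i _ => h.ite_length_nonneg x y i) : (0 : ℝ) ≤
          v + ∑ i ∈ F, if r i ∈ Set.Ioc x y then r i - l i else 0)
      have h2 : Real.tanh ((if r i ∈ Set.Ioc x y then r i - l i else 0) / 2) =
          if r i ∈ Set.Ioc x y then Real.tanh ((r i - l i) / 2) else 0 := by
        split_ifs <;> simp
      linarith
  have hlim := (continuous_tanh.tendsto _).comp ((hsum.const_add v).div_const 2)
  rw [add_sub_cancel] at hlim
  refine le_of_tendsto hlim (Eventually.of_forall fun F => (hF F).trans ?_)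
  refine add_le_add_right (hs.sum_le_tsum F fun i _ => ?_) _
  split_ifs
  exacts [tanh_half_nonneg (sub_nonneg.2 (h.lt i).le), le_rfl]

theorem cumulative_sub_le [Countable ι] (h : IsGapDecomposition A a b l r) {x y : ℝ}
    (hx : x ∈ A) (hy : y ∈ A) (hxy : x ≤ y) :
    cumulative A l r y - cumulative A l r x ≤ (y - x) / 2 := by
  have hsum := (h.hasSum_length hx hy hxy).div_const 2
  have hs := h.summable_ite_tanh fun i => r i ∈ Set.Ioc x y
  rw [h.cumulative_sub hxy]
  have := hs.tsum_le_tsum (fun i => ?_) hsum.summable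
  · rw [hsum.tsum_eq] at this
    linarith
  · split_ifs
    · exact tanh_le_self (div_nonneg (sub_nonneg.2 (h.lt i).le) zero_le_two)
    · simp

/-- Two points of `A` with nothing of `A` between them bound a single gap. -/
theorem cumulative_sub_of_gap [Countable ι] (h : IsGapDecomposition A a b l r) {x y : ℝ}
    (hx : x ∈ A) (hy : y ∈ A) (hxy : x < y) (hgap : ∀ z ∈ A, z ≤ x ∨ y ≤ z) :
    cumulative A l r y - cumulative A l r x = Real.tanh ((y - x) / 2) := by
  obtain ⟨m, hxm, hmy⟩ := exists_between hxy
  obtain ⟨i, hi⟩ : ∃ i, m ∈ Set.Ioo (l i) (r i) := by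
    by_contra hno
    push Not at hno
    rcases hgap m (h.mem_iff.2
      ⟨⟨(h.isLeast.2 hx).trans hxm.le, hmy.le.trans (h.isGreatest.2 hy)⟩, hno⟩) with h' | h'
    exacts [hxm.not_ge h', hmy.not_ge h']
  have hl : l i = x := le_antisymm
    ((hgap _ (h.left_mem i)).resolve_right (by linarith [hi.1]))
    ((h.le_or_le hx i).resolve_right (by linarith [hi.2]))
  have hr : r i = y := le_antisymm
    ((h.le_or_le hy i).resolve_left (by linarith [hi.1]))
    ((hgap _ (h.right_mem i)).resolve_left (by linarith [hi.2]))
  have hv : volume.real (A ∩ Set.Ioc x y) = 0 :=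
    measureReal_mono_null (s₂ := {y})
      (fun z hz => le_antisymm hz.2.2 ((hgap z hz.1).resolve_left (not_le.2 hz.2.1)))
      (by simp [measureReal_def]) (by simp)
  rw [h.cumulative_sub hxy.le, hv, tsum_eq_single i, if_pos (by simp [hr, hxy]), hl, hr]
  · simp
  · intro j hj
    refine if_neg fun hrj => hj ?_
    have hrj' : r j = y :=
      le_antisymm hrj.2 ((hgap _ (h.right_mem j)).resolve_left (not_le.2 hrj.1))
    refine h.eq_of_max_lt_min ?_
    rw [hrj', hr, min_self, ← hrj', max_lt_iff, hl]
    exact ⟨h.lt j, hrj.1⟩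

/-! ### The magnitude of a compact set of reals -/

/-- Extends a finite subset of `A` with largest point `p` to one with largest point `q`, keeping
the deficit of its magnitude against `1 + cumulative` within `ε` per unit of length. -/
theorem exists_insert_max {ε p q : ℝ}
    (hq : q ∈ A) (hpq : p ≤ q)
    (hstep : p < q → cumulative A l r q - cumulative A l r p - ε * (q - p) ≤
      Real.tanh ((q - p) / 2))
    (hB : ∃ (B : Finset ℝ) (m : ℝ), (B : Set ℝ) ⊆ A ∧ IsGreatest (B : Set ℝ) p ∧
      MatrixHasMagnitude (similarityMatrix B) m ∧
      1 + cumulative A l r p - ε * (p - a) ≤ m) :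
    ∃ (B : Finset ℝ) (m : ℝ), (B : Set ℝ) ⊆ A ∧ IsGreatest (B : Set ℝ) q ∧
      MatrixHasMagnitude (similarityMatrix B) m ∧
      1 + cumulative A l r q - ε * (q - a) ≤ m := by
  rcases hpq.eq_or_lt with rfl | hlt
  · exact hB
  · obtain ⟨B, m, hBA, hBp, hm, hle⟩ := hB
    refine ⟨insert q B, _, ?_, ⟨by simp, ?_⟩, hm.insert_max hBp hlt, ?_⟩
    · rw [Finset.coe_insert]
      exact Set.insert_subset hq hBA
    · intro z hz
      rcases Finset.mem_insert.1 hz with rfl | hz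
      · exact le_rfl
      · exact (hBp.2 hz).trans hpq
    · linarith [hstep hlt]

/-- Over a distance of at most `ε`, the estimates `u - u ^ 2 ≤ tanh u` and `cumulative_sub_le` bound
the loss. -/
theorem step_of_sub_le [Countable ι] (h : IsGapDecomposition A a b l r) {ε p q : ℝ}
    (hp : p ∈ A) (hq : q ∈ A) (hpq : p ≤ q) (hε : q - p ≤ ε) :
    cumulative A l r q - cumulative A l r p - ε * (q - p) ≤ Real.tanh ((q - p) / 2) := by
  have h1 := h.cumulative_sub_le hp hq hpq
  have h2 := sub_sq_le_tanh_half (sub_nonneg.2 hpq)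
  nlinarith [mul_nonneg (sub_nonneg.2 hε) (sub_nonneg.2 hpq), sq_nonneg (q - p)]

/-- Finite subsets of `A` with magnitude close to `1 + cumulative`. The induction goes down from `y`:
let `q` be the first point of `A` after `y - ε` and `p` the last one before it. Then `p` and `q`
bound a gap (or coincide), where nothing is lost, and `q` and `y` are within `ε` of each other. -/
theorem exists_finset_magnitude_ge [Countable ι] (h : IsGapDecomposition A a b l r)
    (hA : IsCompact A) {ε : ℝ} (hε : 0 < ε) (n : ℕ) :
    ∀ y ∈ A, y - a ≤ n * ε →
      ∃ (B : Finset ℝ) (m : ℝ), (B : Set ℝ) ⊆ A ∧ IsGreatest (B : Set ℝ) y ∧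
        MatrixHasMagnitude (similarityMatrix B) m ∧
        1 + cumulative A l r y - ε * (y - a) ≤ m := by
  have ha := h.isLeast
  have hbase : ∃ (B : Finset ℝ) (m : ℝ), (B : Set ℝ) ⊆ A ∧ IsGreatest (B : Set ℝ) a ∧
      MatrixHasMagnitude (similarityMatrix B) m ∧
      1 + cumulative A l r a - ε * (a - a) ≤ m :=
    ⟨{a}, 1, by simpa using ha.1, by simp, matrixHasMagnitude_singleton a,
      by simp [h.cumulative_left]⟩
  induction n with
  | zero =>
    intro y hy hya
    obtain rfl : y = a := le_antisymm (by simpa using hya) (ha.2 hy)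
    exact hbase
  | succ n ih =>
    intro y hy hya
    rcases le_or_gt (y - a) ε with hlt | hlt
    · exact exists_insert_max hy (ha.2 hy) (fun _ => h.step_of_sub_le ha.1 hy (ha.2 hy) hlt) hbase
    · obtain ⟨p, hp⟩ := (hA.inter_right isClosed_Iic).exists_isGreatest
        (⟨a, ha.1, by simp only [Set.mem_Iic]; linarith⟩ : (A ∩ Set.Iic (y - ε)).Nonempty)
      obtain ⟨q, hq⟩ := (hA.inter_right isClosed_Ici).exists_isLeast
        (⟨y, hy, by simp only [Set.mem_Ici]; linarith⟩ : (A ∩ Set.Ici (y - ε)).Nonempty)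
      have hp2 : p ≤ y - ε := hp.1.2
      have hq2 : y - ε ≤ q := hq.1.2
      have hqy : q ≤ y := hq.2 ⟨hy, by simp only [Set.mem_Ici]; linarith⟩
      push_cast at hya
      have hBp := ih p hp.1.1 (by linarith)
      have hBq := exists_insert_max hq.1.1 (hp2.trans hq2) (fun hpq => by
        rw [h.cumulative_sub_of_gap hp.1.1 hq.1.1 hpq fun z hz =>
          (le_total z (y - ε)).imp (fun hz' => hp.2 ⟨hz, hz'⟩) fun hz' => hq.2 ⟨hz, hz'⟩]
        nlinarith) hBp
      exact exists_insert_max hy hqy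
        (fun _ => h.step_of_sub_le hq.1.1 hy hqy (by linarith)) hBq

theorem magnitude_eq [Countable ι] (h : IsGapDecomposition A a b l r) (hA : IsCompact A) :
    magnitude A =
      ((1 + (volume A).toReal / 2 + ∑' i, Real.tanh ((r i - l i) / 2) : ℝ) : EReal) := by
  have hT : 1 + (volume A).toReal / 2 + ∑' i, Real.tanh ((r i - l i) / 2) =
      1 + cumulative A l r b := by
    rw [h.cumulative_right, measureReal_def, add_assoc]
  rw [hT]
  refine le_antisymm (sSup_le ?_) (le_of_forall_lt fun c hc => lt_sSup_iff.2 ?_)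
  · rintro _ ⟨B, m, hBA, hm, rfl⟩
    obtain ⟨m', hm', hle⟩ := exists_magnitude_le (fun x _ => h.cumulative_nonneg x)
      (fun x hx y hy hxy => h.tanh_le_cumulative_sub hx hy hxy.le) B hBA
    obtain rfl := hm.unique hm'
    refine EReal.coe_le_coe_iff.2 ?_
    rcases B.eq_empty_or_nonempty with rfl | hne
    · rw [hm.unique matrixHasMagnitude_empty]
      linarith [h.cumulative_nonneg b]
    · have hp := B.isGreatest_max' hne
      have hpA := hBA hp.1
      have hpb := h.isGreatest.2 hpA
      have h1 := h.tanh_le_cumulative_sub hpA h.isGreatest.1 hpb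
      have h2 := tanh_half_nonneg (sub_nonneg.2 hpb)
      linarith [hle _ hp]
  · obtain ⟨c', hcc', hc'⟩ := EReal.lt_iff_exists_real_btwn.1 hc
    rw [EReal.coe_lt_coe_iff] at hc'
    have hab := h.le
    obtain ⟨ε, hε, hεT⟩ : ∃ ε : ℝ, 0 < ε ∧ ε * (b - a) < 1 + cumulative A l r b - c' := by
      refine ⟨(1 + cumulative A l r b - c') / (b - a + 1),
        div_pos (by linarith) (by linarith), ?_⟩
      rw [div_mul_eq_mul_div, div_lt_iff₀ (by linarith)]
      nlinarith
    obtain ⟨n, hn⟩ := exists_nat_ge ((b - a) / ε)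
    obtain ⟨B, m, hBA, -, hm, hle⟩ := h.exists_finset_magnitude_ge hA hε n b h.isGreatest.1
      ((div_le_iff₀ hε).1 hn)
    exact ⟨m, ⟨B, m, hBA, hm, rfl⟩, hcc'.trans (EReal.coe_lt_coe_iff.2 (by linarith))⟩

end IsGapDecomposition

end MetricMagnitude

namespace MetricMagnitude

open MeasureTheory Pointwise

/-! ### The gaps of the ternary Cantor set -/

/-- The left end point of the gap of the ternary Cantor set that is reached by the word `w`: the
empty word stands for the middle third `(1/3, 2/3)`, a leading `false` for the left copy of the
Cantor set and a leading `true` for the right copy. -/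
noncomputable def cantorGapLeft : List Bool → ℝ
  | [] => 1 / 3
  | false :: w => cantorGapLeft w / 3
  | true :: w => (2 + cantorGapLeft w) / 3

/-- The right end point of the gap reached by the word `w`. -/
noncomputable def cantorGapRight (w : List Bool) : ℝ :=
  cantorGapLeft w + 1 / 3 ^ (w.length + 1)

/-- The gap of the ternary Cantor set reached by the word `w`. -/
def cantorGap (w : List Bool) : Set ℝ := Set.Ioo (cantorGapLeft w) (cantorGapRight w)

theorem mem_cantorGap_nil {x : ℝ} : x ∈ cantorGap [] ↔ 1 / 3 < x ∧ x < 2 / 3 := by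
  simp only [cantorGap, cantorGapRight, cantorGapLeft, Set.mem_Ioo, List.length_nil]
  norm_num

theorem mem_cantorGap_false {w : List Bool} {x : ℝ} :
    x ∈ cantorGap (false :: w) ↔ 3 * x ∈ cantorGap w := by
  have : (1 : ℝ) / 3 ^ (w.length + 1 + 1) = 1 / 3 ^ (w.length + 1) / 3 := by
    rw [pow_succ _ (w.length + 1), div_div]
  simp only [cantorGap, cantorGapRight, cantorGapLeft, Set.mem_Ioo, List.length_cons, this]
  constructor <;> rintro ⟨h1, h2⟩ <;> constructor <;> linarith

theorem mem_cantorGap_true {w : List Bool} {x : ℝ} :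
    x ∈ cantorGap (true :: w) ↔ 3 * x - 2 ∈ cantorGap w := by
  have : (1 : ℝ) / 3 ^ (w.length + 1 + 1) = 1 / 3 ^ (w.length + 1) / 3 := by
    rw [pow_succ _ (w.length + 1), div_div]
  simp only [cantorGap, cantorGapRight, cantorGapLeft, Set.mem_Ioo, List.length_cons, this]
  constructor <;> rintro ⟨h1, h2⟩ <;> constructor <;> linarith

theorem cantorGap_subset (w : List Bool) : cantorGap w ⊆ Set.Ioo 0 1 := by
  induction w with
  | nil =>
    intro x hx
    rw [mem_cantorGap_nil] at hx
    constructor <;> linarith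
  | cons c w ih =>
    intro x hx
    cases c
    · have := ih (mem_cantorGap_false.1 hx)
      constructor <;> linarith [this.1, this.2]
    · have := ih (mem_cantorGap_true.1 hx)
      constructor <;> linarith [this.1, this.2]

theorem eq_of_mem_cantorGap (w : List Bool) :
    ∀ (w' : List Bool) (x : ℝ), x ∈ cantorGap w → x ∈ cantorGap w' → w = w' := by
  induction w with
  | nil =>
    rintro (_ | ⟨_ | _, w'⟩) x hx hx'
    · rfl
    · rw [mem_cantorGap_nil] at hx
      linarith [(cantorGap_subset _ (mem_cantorGap_false.1 hx')).2]
    · rw [mem_cantorGap_nil] at hx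
      linarith [(cantorGap_subset _ (mem_cantorGap_true.1 hx')).1]
  | cons c w ih =>
    rintro (_ | ⟨c', w'⟩) x hx hx'
    · rw [mem_cantorGap_nil] at hx'
      cases c
      · linarith [(cantorGap_subset _ (mem_cantorGap_false.1 hx)).2]
      · linarith [(cantorGap_subset _ (mem_cantorGap_true.1 hx)).1]
    · cases c <;> cases c'
      · rw [ih w' _ (mem_cantorGap_false.1 hx) (mem_cantorGap_false.1 hx')]
      · linarith [(cantorGap_subset _ (mem_cantorGap_false.1 hx)).2,
          (cantorGap_subset _ (mem_cantorGap_true.1 hx')).1]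
      · linarith [(cantorGap_subset _ (mem_cantorGap_true.1 hx)).1,
          (cantorGap_subset _ (mem_cantorGap_false.1 hx')).2]
      · rw [ih w' _ (mem_cantorGap_true.1 hx) (mem_cantorGap_true.1 hx')]

theorem notMem_cantorSet_of_mem_cantorGap (w : List Bool) :
    ∀ x ∈ cantorGap w, x ∉ cantorSet := by
  have hhalf : ∀ x ∈ cantorSet, (x ≤ 1 / 3 ∧ 3 * x ∈ cantorSet) ∨
      (2 / 3 ≤ x ∧ 3 * x - 2 ∈ cantorSet) := by
    intro x hx
    rw [cantorSet_eq_union_halves] at hx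
    rcases hx with ⟨y, hy, rfl⟩ | ⟨y, hy, rfl⟩
    · refine Or.inl ⟨by simp only; linarith [(cantorSet_subset_unitInterval hy).2], ?_⟩
      simpa only [mul_div_cancel₀ y (three_ne_zero' ℝ)] using hy
    · refine Or.inr ⟨by simp only; linarith [(cantorSet_subset_unitInterval hy).1], ?_⟩
      simpa only [mul_div_cancel₀ (2 + y) (three_ne_zero' ℝ), add_sub_cancel_left] using hy
  induction w with
  | nil =>
    intro x hx hxC
    rw [mem_cantorGap_nil] at hx
    rcases hhalf x hxC with h | h
    · linarith [h.1]
    · linarith [h.1]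
  | cons c w ih =>
    intro x hx hxC
    cases c
    · rw [mem_cantorGap_false] at hx
      rcases hhalf x hxC with h | h
      · exact ih _ hx h.2
      · linarith [(cantorGap_subset _ hx).2, h.1]
    · rw [mem_cantorGap_true] at hx
      rcases hhalf x hxC with h | h
      · linarith [(cantorGap_subset _ hx).1, h.1]
      · exact ih _ hx h.2

theorem exists_mem_cantorGap_of_notMem_preCantorSet (n : ℕ) :
    ∀ x ∈ Set.Icc (0 : ℝ) 1, x ∉ preCantorSet n → ∃ w, x ∈ cantorGap w := by
  induction n with
  | zero => exact fun x hx hx' => absurd hx hx'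
  | succ n ih =>
    intro x hx hxn
    rw [preCantorSet_succ, Set.mem_union, not_or] at hxn
    rcases le_or_gt x (1 / 3) with h1 | h1
    · obtain ⟨w, hw⟩ := ih (3 * x) ⟨by linarith [hx.1], by linarith⟩
        fun h => hxn.1 ⟨3 * x, h, by simp⟩
      exact ⟨false :: w, mem_cantorGap_false.2 hw⟩
    rcases lt_or_ge x (2 / 3) with h2 | h2
    · exact ⟨[], mem_cantorGap_nil.2 ⟨h1, h2⟩⟩
    · obtain ⟨w, hw⟩ := ih (3 * x - 2) ⟨by linarith, by linarith [hx.2]⟩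
        fun h => hxn.2 ⟨3 * x - 2, h, by simp⟩
      exact ⟨true :: w, mem_cantorGap_true.2 hw⟩

theorem isGapDecomposition_cantorSet :
    IsGapDecomposition cantorSet 0 1 cantorGapLeft cantorGapRight where
  le := zero_le_one
  lt w := lt_add_of_pos_right _ (by positivity)
  subset w := (cantorGap_subset w).trans Set.Ioo_subset_Icc_self
  disjoint w w' hw := Set.disjoint_left.2 fun x hx hx' => hw (eq_of_mem_cantorGap w w' x hx hx')
  eq_diff := by
    ext x
    simp only [Set.mem_sdiff, Set.mem_iUnion, not_exists]
    refine ⟨fun hx => ⟨cantorSet_subset_unitInterval hx,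
      fun w hw => notMem_cantorSet_of_mem_cantorGap w x hw hx⟩, fun ⟨hx, hgap⟩ => ?_⟩
    refine Set.mem_iInter.2 fun n => by_contra fun hn => ?_
    obtain ⟨w, hw⟩ := exists_mem_cantorGap_of_notMem_preCantorSet n x hx hn
    exact hgap w hw

theorem IsGapDecomposition.const_mul {A : Set ℝ} {a b : ℝ} {ι : Type*} {l r : ι → ℝ}
    (h : IsGapDecomposition A a b l r) {c : ℝ} (hc : 0 < c) :
    IsGapDecomposition ((fun x => c * x) '' A) (c * a) (c * b) (fun i => c * l i)
      (fun i => c * r i) where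
  le := mul_le_mul_of_nonneg_left h.le hc.le
  lt i := mul_lt_mul_of_pos_left (h.lt i) hc
  subset i := by
    rw [← Set.image_mul_left_Ioo hc, ← Set.image_mul_left_Icc' hc]
    exact Set.image_mono (h.subset i)
  disjoint i j hij := by
    simp only [← Set.image_mul_left_Ioo hc]
    exact (Set.disjoint_image_iff (mul_right_injective₀ hc.ne')).2 (h.disjoint hij)
  eq_diff := by
    rw [h.eq_diff, Set.image_sdiff (mul_right_injective₀ hc.ne'), Set.image_iUnion]
    simp only [Set.image_mul_left_Ioo hc, Set.image_mul_left_Icc' hc]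

/-- By self-similarity, the volume `v` satisfies `v ≤ v / 3 + v / 3`. -/
theorem volume_cantorSet : volume cantorSet = 0 := by
  have hfin : volume cantorSet ≠ ⊤ := isCompact_cantorSet.measure_ne_top
  have h1 : volume.real ((1 / 3 : ℝ) • cantorSet) = volume.real cantorSet / 3 := by
    rw [measureReal_def, Measure.addHaar_smul_of_nonneg _ (by norm_num), ENNReal.toReal_mul,
      ENNReal.toReal_ofReal (by positivity), Module.finrank_self, measureReal_def]
    ring
  have h2 : volume.real ((fun x : ℝ => 2 / 3 + x) '' ((1 / 3 : ℝ) • cantorSet)) =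
      volume.real cantorSet / 3 := by
    rw [← h1, Set.image_add_left, measureReal_def, measure_preimage_add, measureReal_def]
  have hunion : cantorSet = (1 / 3 : ℝ) • cantorSet ∪
      (fun x : ℝ => 2 / 3 + x) '' ((1 / 3 : ℝ) • cantorSet) := by
    conv_lhs => rw [cantorSet_eq_union_halves]
    rw [← Set.image_smul, Set.image_image]
    congr 2 <;> funext x <;> simp only [smul_eq_mul] <;> ring
  have h3 := measureReal_union_le (μ := volume) ((1 / 3 : ℝ) • cantorSet)
    ((fun x : ℝ => 2 / 3 + x) '' ((1 / 3 : ℝ) • cantorSet))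
  rw [← hunion, h1, h2] at h3
  have h0 : volume.real cantorSet = 0 := by
    linarith [measureReal_nonneg (μ := volume) (s := cantorSet)]
  exact (measureReal_eq_zero_iff hfin).1 h0

theorem volume_cantorSetOfLength (ℓ : ℝ) : volume (cantorSetOfLength ℓ) = 0 := by
  have := Measure.addHaar_smul volume ℓ cantorSet
  rw [volume_cantorSet, mul_zero] at this
  exact this

theorem isCompact_cantorSetOfLength (ℓ : ℝ) : IsCompact (cantorSetOfLength ℓ) :=
  isCompact_cantorSet.image (continuous_const_mul ℓ)

/-- A function of the length of a word, summed over all binary words. -/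
theorem hasSum_pow_two_mul_of_length {f : ℕ → ℝ}
    (hf : Summable fun w : List Bool => f w.length) :
    HasSum (fun n : ℕ => (2 : ℝ) ^ n * f n) (∑' w : List Bool, f w.length) := by
  have h := (List.equivSigmaTuple (α := Bool)).symm.hasSum_iff.2 hf.hasSum
  have h' := h.sigma fun n => hasSum_fintype _
  convert h' using 1
  funext n
  simp [List.equivSigmaTuple]

theorem summable_and_magnitude_cantorSetOfLength {ℓ : ℝ} (hℓ : 0 < ℓ) :
    Summable (fun i : ℕ => (2 : ℝ) ^ (i + 1) * Real.tanh (ℓ / (2 * 3 ^ (i + 1)))) ∧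
      magnitude (cantorSetOfLength ℓ) =
        ((1 + (1 / 2) * ∑' i : ℕ, (2 : ℝ) ^ (i + 1) * Real.tanh (ℓ / (2 * 3 ^ (i + 1))) : ℝ) :
          EReal) := by
  have h : IsGapDecomposition (cantorSetOfLength ℓ) _ _ _ _ :=
    isGapDecomposition_cantorSet.const_mul hℓ
  have hlen : ∀ w : List Bool, (ℓ * cantorGapRight w - ℓ * cantorGapLeft w) / 2 =
      ℓ / (2 * 3 ^ (w.length + 1)) := fun w => by
    rw [cantorGapRight]
    field_simp
    ring
  have hs := h.summable_tanh
  have hm := h.magnitude_eq (isCompact_cantorSetOfLength ℓ)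
  simp only [hlen] at hs hm
  have hsum := (hasSum_pow_two_mul_of_length
    (f := fun n => Real.tanh (ℓ / (2 * 3 ^ (n + 1)))) hs).mul_left 2
  simp only [← mul_assoc, ← pow_succ'] at hsum
  refine ⟨hsum.summable, ?_⟩
  rw [hm, hsum.tsum_eq, volume_cantorSetOfLength]
  congr 1
  simp

end MetricMagnitude

theorem corollaryT :
    -- every nonempty compact set of reals has a decomposition into an interval minus gaps
    (∀ A : Set ℝ, IsCompact A → A.Nonempty →
      ∃ (ι : Type) (a b : ℝ) (l r : ι → ℝ),
        Countable ι ∧ MetricMagnitude.IsGapDecomposition A a b l r) ∧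
    -- the magnitude in terms of any such decomposition
    (∀ A : Set ℝ, IsCompact A →
      ∀ (ι : Type*) [Countable ι] (a b : ℝ) (l r : ι → ℝ),
        MetricMagnitude.IsGapDecomposition A a b l r →
        MetricMagnitude.IsPositiveDefinite A ∧
        Summable (fun i => Real.tanh ((r i - l i) / 2)) ∧
        MetricMagnitude.magnitude A =
          ((1 + (MeasureTheory.volume A).toReal / 2 + ∑' i, Real.tanh ((r i - l i) / 2) : ℝ) :
            EReal)) ∧
    -- the magnitude of the ternary Cantor set of length `ℓ`
    (∀ ℓ : ℝ, 0 < ℓ →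
      Summable (fun i : ℕ => (2 : ℝ) ^ (i + 1) * Real.tanh (ℓ / (2 * 3 ^ (i + 1)))) ∧
      MetricMagnitude.magnitude (MetricMagnitude.cantorSetOfLength ℓ) =
        ((1 + (1 / 2) * ∑' i : ℕ, (2 : ℝ) ^ (i + 1) * Real.tanh (ℓ / (2 * 3 ^ (i + 1))) : ℝ) :
          EReal)) := by
  exact ⟨fun A hA hne => MetricMagnitude.exists_isGapDecomposition hA hne,
    fun A hA ι _ a b l r h =>
      ⟨MetricMagnitude.isPositiveDefinite_real A, h.summable_tanh, h.magnitude_eq hA⟩,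
    fun ℓ hℓ => MetricMagnitude.summable_and_magnitude_cantorSetOfLength hℓ⟩
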